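/- Let $R$ be a ring with unit and let $\mathcal V$ be a variety (equational class) of unital $R$-modules expanded by $R$-multilinear operations $f\in F$ of arities $n=n_f\ge 1$. Let $A\in\mathcal V$, let $\pi:A\to Q$ be a surjective homomorphism, $I=\ker\pi$ (an algebra under the restricted operations), and let $T$ be the 2-cocycle associated to $\pi$ by a lifting $l:Q\to A$ ($\pi\circ l=\mathrm{id}_Q$, $l(0)=0$), as defined below. Then \[ 1\longrightarrow \mathrm{Der}(Q,I)\stackrel{\iota}{\longrightarrow}\mathrm{Aut}_I A\stackrel{\psi}{\longrightarrow}\mathrm{Aut}\,I\times\mathrm{Aut}\,Q\stackrel{W_T}{\longrightarrow} FA\big(H^2_{\mathcal V}(Q,I)\big) \] is exact: $\iota$ and $\psi$ are well-defined group homomorphisms, $\iota$ is injective, $\operatorname{im}\iota=\ker\psi$, and $\operatorname{im}\psi=\{(\sigma,\kappa): W_T(\sigma,\kappa)=0\}$. The terms are as follows. Write $[n]^*$ for the set of nonempty proper subsets of $[n]=\{1,\dots,n\}$; for tuples $\vec b,\vec a$ and $s\subseteq[n]$, $\vec b_s[\vec a]$ is $\vec b$ with the entries at the places in $s$ replaced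 by those of $\vec a$. (1) A factor system $T=(T_+,T_r,T_f,a(f,s))$ $(r\in R,\ f\in F,\ s\in[n_f]^*)$ consists of maps $T_+:Q^2\to I$, $T_r:Q\to I$, $T_f:Q^{n}\to I$ and $a(f,s):Q^{[n]\setminus s}\times I^{s}\to I$. We write $a(f,s)(\vec x,\vec a)$ also for full tuples $\vec x\in Q^n,\vec a\in I^n$; only the $x_i$ with $i\notin s$ and the $a_i$ with $i\in s$ are used. $I\rtimes_T Q$ is the set $I\times Q$ with zero $\langle 0,0\rangle$ and operations $\langle a,x\rangle+\langle b,y\rangle=\langle a+b+T_+(x,y),x+y\rangle$, $r\langle a,x\rangle=\langle ra+T_r(x),rx\rangle$, and, for $a_1,\dots,a_n\in I$, $x_1,\dots,x_n\in Q$, \[ F_f(\langle a_1,x_1\rangle,\dots,\langle a_n,x_n\rangle)=\Big\langle f^I(\vec a)+\sum_{s\in[n]^*}a(f,s)(\vec x,\vec a)+T_f(\vec x),\ f^Q(\vec x)\Big\rangle . \] $T$ is a 2-cocycle compatible with $\mathcal V$, written $T\in Z^2_{\mathcal V}(Q,I)$, if each $a(f,s)$ vanishes whenever one of its arguments is $0$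 and $I\rtimes_TQ\in\mathcal V$. The 2-cocycle associated to $\pi$ by $l$ is $T_+(x,y)=l(x)+l(y)-l(x+y)$, $T_r(x)=r\,l(x)-l(rx)$, $T_f(\vec x)=f^A(l(\vec x))-l(f^Q(\vec x))$, $a(f,s)(\vec x,\vec a)=f^A\big(l(\vec x)_s[\vec a]\big)$; it belongs to $Z^2_{\mathcal V}(Q,I)$. (2) $H^2_{\mathcal V}(Q,I)=Z^2_{\mathcal V}(Q,I)/{\sim}$, where $T\sim T'$ iff there is $h:Q\to I$ with $h(0)=0$ such that for all $x,y\in Q$, $r\in R$, $f\in F$ (with $n=n_f$), $s\in[n]^*$, $\vec x\in Q^n$, $\vec a\in I^n$: $T_+(x,y)-T'_+(x,y)=h(x)+h(y)-h(x+y)$; $T_r(x)-T'_r(x)=r\,h(x)-h(rx)$; \[ T_f(\vec x)-T'_f(\vec x)=\sum_{s\in[n]^*}(-1)^{1+|s|}a(f,s)(\vec x,h(\vec x))+(-1)^{1+n}f^I(h(\vec x))-h(f^Q(\vec x)); \] \[ a(f,s)(\vec x,\vec a)-a'(f,s)(\vec x,\vec a)=\sum_{s\subsetneq r\subsetneq[n]}(-1)^{1+|r|-|s|}a(f,r)\big(\vec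 x,h(\vec x)_s[\vec a]\big)+(-1)^{1+n-|s|}f^I\big(h(\vec x)_s[\vec a]\big). \] $FA(X)$ is the free abelian group on the set $X$. (3) $\mathrm{Der}(Q,I)$ is the set of $R$-linear $d:Q\to I$ such that for all $f\in F$ (with $n=n_f$), $s\in[n]^*$, $\vec x\in Q^n$, $\vec a\in I^n$: $d(f^Q(\vec x))=\sum_{s\in[n]^*}a(f,s)(\vec x,d(\vec x))+f^I(d(\vec x))$ and $\sum_{s\subsetneq r\subsetneq[n]}a(f,r)(\vec x,d(\vec x)_s[\vec a])+f^I(d(\vec x)_s[\vec a])=0$, where the $a(f,s)$ are the action terms of the associated $T$. It is a group under pointwise addition, and $\iota(d)(a)=a+d(\pi(a))$. (4) $\mathrm{Aut}_IA=\{\phi\in\mathrm{Aut}\,A:\phi(I)=I\}$ and $\psi(\phi)=(\phi|_I,\ \pi\circ\phi\circ l')$, where $l'$ is any map with $\pi\circ l'=\mathrm{id}_Q$; the result does not depend on $l'$. (5) $W_T(\sigma,\kappa)=[T]-[T^{(\sigma,\kappa)}]$ is the formal difference in $FA(H^2_{\mathcal V}(Q,I))$, where $T^{(\sigma,\kappa)}\in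 Z^2_{\mathcal V}(Q,I)$ is given by $T^{(\sigma,\kappa)}_+(x,y)=\sigma T_+(\kappa^{-1}x,\kappa^{-1}y)$, $T^{(\sigma,\kappa)}_r(x)=\sigma T_r(\kappa^{-1}x)$, $T^{(\sigma,\kappa)}_f(\vec x)=\sigma T_f(\kappa^{-1}\vec x)$ and $a(f,s)^{(\sigma,\kappa)}(\vec x,\vec a)=\sigma\,a(f,s)(\kappa^{-1}\vec x,\sigma^{-1}\vec a)$. -/

import Mathlib

/-- A signature of multilinear operation symbols. Every symbol takes at least one argument. -/
structure MultSig where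
  Op : Type*
  arity : Op → ℕ
  arity_pos : ∀ f, 0 < arity f

/-- An `R`-module expanded by multilinear operations named by the symbols of `S`. -/
class MultAlg (R : Type*) [Ring R] (S : MultSig) (A : Type*) [AddCommGroup A] [Module R A] where
  op : (f : S.Op) → MultilinearMap R (fun _ : Fin (S.arity f) => A) A

/-! ### Terms, identities and varieties -/

/-- A set with operations in the signature `{0, +, r · (r ∈ R)} ∪ S`, not subject to any law. -/
structure RawAlg (R : Type*) (S : MultSig) (X : Type*) where
  zero : X
  add : X → X → X
  smul : R → X → X
  op : (f : S.Op) → (Fin (S.arity f) → X) → X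

/-- Terms in the signature `{0, +, r · (r ∈ R)} ∪ S` over countably many variables. -/
inductive MTerm (R : Type*) (S : MultSig)
  | var (n : ℕ) : MTerm R S
  | zero : MTerm R S
  | add (t s : MTerm R S) : MTerm R S
  | smul (r : R) (t : MTerm R S) : MTerm R S
  | op (f : S.Op) (t : Fin (S.arity f) → MTerm R S) : MTerm R S

/-- The value of a term under an assignment of the variables. -/
def MTerm.eval {R : Type*} {S : MultSig} {X : Type*} (B : RawAlg R S X) (v : ℕ → X) :
    MTerm R S → X
  | .var n => v n
  | .zero => B.zero
  | .add t s => B.add (t.eval B v) (s.eval B v)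
  | .smul r t => B.smul r (t.eval B v)
  | .op f t => B.op f (fun i => (t i).eval B v)

/-- The laws of unital `R`-modules and the multilinearity laws of the operations of `S`. -/
inductive BaseLaw (R : Type*) [Ring R] (S : MultSig) : MTerm R S → MTerm R S → Prop
  | add_assoc : BaseLaw R S (.add (.add (.var 0) (.var 1)) (.var 2))
      (.add (.var 0) (.add (.var 1) (.var 2)))
  | add_comm : BaseLaw R S (.add (.var 0) (.var 1)) (.add (.var 1) (.var 0))
  | zero_add : BaseLaw R S (.add .zero (.var 0)) (.var 0)
  | one_smul : BaseLaw R S (.smul 1 (.var 0)) (.var 0)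
  | zero_smul : BaseLaw R S (.smul 0 (.var 0)) .zero
  | mul_smul (r s : R) : BaseLaw R S (.smul (r * s) (.var 0)) (.smul r (.smul s (.var 0)))
  | add_smul (r s : R) : BaseLaw R S (.smul (r + s) (.var 0))
      (.add (.smul r (.var 0)) (.smul s (.var 0)))
  | smul_add (r : R) : BaseLaw R S (.smul r (.add (.var 0) (.var 1)))
      (.add (.smul r (.var 0)) (.smul r (.var 1)))
  | op_add (f : S.Op) (i : Fin (S.arity f)) : BaseLaw R S
      (.op f (Function.update (fun j : Fin (S.arity f) => MTerm.var (j : ℕ)) i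
        (.add (.var i) (.var (S.arity f)))))
      (.add (.op f (fun j : Fin (S.arity f) => MTerm.var (j : ℕ)))
        (.op f (Function.update (fun j : Fin (S.arity f) => MTerm.var (j : ℕ)) i
          (.var (S.arity f)))))
  | op_smul (f : S.Op) (i : Fin (S.arity f)) (r : R) : BaseLaw R S
      (.op f (Function.update (fun j : Fin (S.arity f) => MTerm.var (j : ℕ)) i
        (.smul r (.var i))))
      (.smul r (.op f (fun j : Fin (S.arity f) => MTerm.var (j : ℕ))))

/-- A variety of `R`-modules expanded by multilinear operations, given by a set of identities
that contains the module and multilinearity laws. -/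
structure MultVariety (R : Type*) [Ring R] (S : MultSig) where
  identities : Set (MTerm R S × MTerm R S)
  base : ∀ t s, BaseLaw R S t s → (t, s) ∈ identities

/-- Membership of an algebra in a variety: all identities hold under all assignments. -/
def MultVariety.Mem {R : Type*} [Ring R] {S : MultSig} (V : MultVariety R S) {X : Type*}
    (B : RawAlg R S X) : Prop :=
  ∀ p ∈ V.identities, ∀ v : ℕ → X, p.1.eval B v = p.2.eval B v

/-- The underlying algebra, in the full signature, of a module with multilinear operations. -/
def MultAlg.toRaw (R : Type*) [Ring R] (S : MultSig) (A : Type*) [AddCommGroup A] [Module R A]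
    [MultAlg R S A] : RawAlg R S A where
  zero := 0
  add a b := a + b
  smul r a := r • a
  op f a := MultAlg.op (R := R) f a

theorem MTerm.eval_hom {R : Type*} {S : MultSig} {X Y : Type*} (B : RawAlg R S X)
    (C : RawAlg R S Y) (e : X → Y) (h0 : e B.zero = C.zero)
    (ha : ∀ x y, e (B.add x y) = C.add (e x) (e y))
    (hs : ∀ r x, e (B.smul r x) = C.smul r (e x))
    (ho : ∀ f x, e (B.op f x) = C.op f (fun i => e (x i))) (v : ℕ → X) (t : MTerm R S) :
    e (t.eval B v) = t.eval C (fun n => e (v n)) := by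
  induction t with
  | var n => rfl
  | zero => exact h0
  | add t s iht ihs => simp only [MTerm.eval, ha, iht, ihs]
  | smul r t ih => simp only [MTerm.eval, hs, ih]
  | op f t ih => simp only [MTerm.eval, ho, ih]

theorem MultVariety.Mem.of_injective {R : Type*} [Ring R] {S : MultSig} {V : MultVariety R S}
    {X Y : Type*} {B : RawAlg R S X} {C : RawAlg R S Y} (hC : V.Mem C) (e : X → Y)
    (he : Function.Injective e) (h0 : e B.zero = C.zero)
    (ha : ∀ x y, e (B.add x y) = C.add (e x) (e y))
    (hs : ∀ r x, e (B.smul r x) = C.smul r (e x))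
    (ho : ∀ f x, e (B.op f x) = C.op f (fun i => e (x i))) : V.Mem B := by
  intro p hp v
  apply he
  rw [MTerm.eval_hom B C e h0 ha hs ho, MTerm.eval_hom B C e h0 ha hs ho]
  exact hC p hp _

/-! ### Homomorphisms, kernels and automorphism groups -/

/-- Homomorphisms of modules with multilinear operations. -/
structure MultHom (R : Type*) [Ring R] (S : MultSig) (A Q : Type*)
    [AddCommGroup A] [Module R A] [MultAlg R S A]
    [AddCommGroup Q] [Module R Q] [MultAlg R S Q] extends A →ₗ[R] Q where
  map_op : ∀ (f : S.Op) (a : Fin (S.arity f) → A),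
    toLinearMap (MultAlg.op (R := R) f a) = MultAlg.op (R := R) f (fun i => toLinearMap (a i))

/-- The kernel ideal of a homomorphism. -/
abbrev MultHom.ker {R : Type*} [Ring R] {S : MultSig} {A Q : Type*}
    [AddCommGroup A] [Module R A] [MultAlg R S A] [AddCommGroup Q] [Module R Q] [MultAlg R S Q]
    (π : MultHom R S A Q) : Submodule R A :=
  LinearMap.ker π.toLinearMap

theorem MultHom.op_mem_ker {R : Type*} [Ring R] {S : MultSig} {A Q : Type*}
    [AddCommGroup A] [Module R A] [MultAlg R S A] [AddCommGroup Q] [Module R Q] [MultAlg R S Q]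
    (π : MultHom R S A Q) (f : S.Op) (a : Fin (S.arity f) → A) (i : Fin (S.arity f))
    (hi : a i ∈ π.ker) : MultAlg.op (R := R) f a ∈ π.ker := by
  rw [LinearMap.mem_ker, π.map_op]
  exact (MultAlg.op (R := R) f).map_coord_zero i hi

/-- The kernel ideal as an algebra, with the restricted operations. -/
instance MultHom.instMultAlgKer {R : Type*} [Ring R] {S : MultSig} {A Q : Type*}
    [AddCommGroup A] [Module R A] [MultAlg R S A] [AddCommGroup Q] [Module R Q] [MultAlg R S Q]
    (π : MultHom R S A Q) : MultAlg R S π.ker where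
  op f := ((MultAlg.op (R := R) (A := A) f).compLinearMap (fun _ => π.ker.subtype)).codRestrict
    π.ker (fun v => π.op_mem_ker f _ ⟨0, S.arity_pos f⟩ (v ⟨0, S.arity_pos f⟩).2)

/-- `Aut A`: the group (under composition) of automorphisms of a module with multilinear
operations. -/
def MultAut (R : Type*) [Ring R] (S : MultSig) (A : Type*)
    [AddCommGroup A] [Module R A] [MultAlg R S A] : Subgroup (A ≃ₗ[R] A) where
  carrier := {φ | ∀ (f : S.Op) (a : Fin (S.arity f) → A),
    φ (MultAlg.op (R := R) f a) = MultAlg.op (R := R) f (fun i => φ (a i))}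
  mul_mem' {φ χ} hφ hχ f a := by
    rw [LinearEquiv.mul_apply, hχ f a, hφ f]
    rfl
  one_mem' _ _ := rfl
  inv_mem' {φ} hφ f a := by
    apply φ.injective
    have h1 : ∀ b : A, φ (φ⁻¹ b) = b := fun b => φ.apply_symm_apply b
    rw [h1, hφ f]
    simp only [h1]

/-- `Aut_I A`: the automorphisms `φ` of `A` with `φ(I) = I`, where `I` is the kernel of `π`. -/
def MultAutKer {R : Type*} [Ring R] {S : MultSig} {A Q : Type*}
    [AddCommGroup A] [Module R A] [MultAlg R S A] [AddCommGroup Q] [Module R Q] [MultAlg R S Q]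
    (π : MultHom R S A Q) : Subgroup (MultAut R S A) where
  carrier := {φ | ∀ a : A, φ.1 a ∈ π.ker ↔ a ∈ π.ker}
  mul_mem' {φ χ} hφ hχ a := (hφ (χ.1 a)).trans (hχ a)
  one_mem' _ := Iff.rfl
  inv_mem' {φ} hφ a := by
    have h1 : φ.1 ((φ⁻¹).1 a) = a := φ.1.apply_symm_apply a
    rw [← hφ ((φ⁻¹).1 a), h1]

/-! ### 2-cocycles and second cohomology -/

/-- `[n]^*`: the proper non-empty sets of argument places of the operation symbol `f`. -/
abbrev PropSub {S : MultSig} (f : S.Op) : Type :=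
  {s : Finset (Fin (S.arity f)) // s.Nonempty ∧ s ≠ Finset.univ}

/-- The data `(T_+, T_r, T_f, a(f,s))` of a factor system of `Q` with values in `I`. The action
term `a(f,s)` takes arguments from `Q` at the places outside `s` and from `I` at those in `s`. -/
@[ext]
structure FactorData (R : Type*) (S : MultSig) (Q I : Type*) where
  add : Q → Q → I
  smul : R → Q → I
  op : (f : S.Op) → (Fin (S.arity f) → Q) → I
  act : (f : S.Op) → (s : PropSub f) →
    ({i : Fin (S.arity f) // i ∉ s.1} → Q) → ({i : Fin (S.arity f) // i ∈ s.1} → I) → I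

section Cocycles

variable {R : Type*} [Ring R] {S : MultSig} {Q I : Type*}
  [AddCommGroup Q] [Module R Q] [MultAlg R S Q] [AddCommGroup I] [Module R I] [MultAlg R S I]

/-- `a(f,s)(x,a)` for full tuples `x` in `Q` and `a` in `I`. -/
def FactorData.actAt (T : FactorData R S Q I) (f : S.Op) (s : PropSub f)
    (x : Fin (S.arity f) → Q) (a : Fin (S.arity f) → I) : I :=
  T.act f s (fun i => x i) (fun i => a i)

/-- The algebra `I ⋊_T Q` on the set `I × Q`. -/
def FactorData.semidirect (T : FactorData R S Q I) : RawAlg R S (I × Q) where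
  zero := (0, 0)
  add p q := (p.1 + q.1 + T.add p.2 q.2, p.2 + q.2)
  smul r p := (r • p.1 + T.smul r p.2, r • p.2)
  op f p := (MultAlg.op (R := R) f (fun i => (p i).1)
      + ∑ s : PropSub f, T.actAt f s (fun i => (p i).2) (fun i => (p i).1)
      + T.op f (fun i => (p i).2),
    MultAlg.op (R := R) f (fun i => (p i).2))

/-- `T` is a 2-cocycle compatible with `V`: its action terms vanish when some argument is zero,
and `I ⋊_T Q` satisfies all identities of `V`. -/
structure FactorData.IsCocycle (V : MultVariety R S) (T : FactorData R S Q I) : Prop where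
  act_zero_left : ∀ (f : S.Op) (s : PropSub f) x a, (∃ i, x i = 0) → T.act f s x a = 0
  act_zero_right : ∀ (f : S.Op) (s : PropSub f) x a, (∃ i, a i = 0) → T.act f s x a = 0
  mem : V.Mem T.semidirect

/-- `h : Q → I` witnesses that `T` and `T'` are equivalent, i.e. that `T - T'` is the
2-coboundary of `h`. Here `s.piecewise a (h ∘ x)` is the tuple `h(x)` with its entries at the
places in `s` replaced by those of `a`. -/
structure FactorData.IsCobounding (T T' : FactorData R S Q I) (h : Q → I) : Prop where
  map_zero : h 0 = 0
  add : ∀ x y, T.add x y - T'.add x y = h x + h y - h (x + y)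
  smul : ∀ r x, T.smul r x - T'.smul r x = r • h x - h (r • x)
  op : ∀ (f : S.Op) (x : Fin (S.arity f) → Q),
    T.op f x - T'.op f x =
      ∑ s : PropSub f, (-1 : ℤ) ^ (1 + s.1.card) • T.actAt f s x (h ∘ x)
        + (-1 : ℤ) ^ (1 + S.arity f) • MultAlg.op (R := R) f (h ∘ x)
        - h (MultAlg.op (R := R) f x)
  act : ∀ (f : S.Op) (s : PropSub f) (x : Fin (S.arity f) → Q) (a : Fin (S.arity f) → I),
    T.actAt f s x a - T'.actAt f s x a =
      ∑ r : PropSub f with s.1 ⊂ r.1,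
          (-1 : ℤ) ^ (1 + (r.1.card - s.1.card)) • T.actAt f r x (s.1.piecewise a (h ∘ x))
        + (-1 : ℤ) ^ (1 + (S.arity f - s.1.card)) •
            MultAlg.op (R := R) f (s.1.piecewise a (h ∘ x))

variable (Q I) in
/-- `Z²_V(Q,I)`: the 2-cocycles compatible with `V`. -/
def Cocycle (V : MultVariety R S) : Type _ :=
  {T : FactorData R S Q I // T.IsCocycle V}

variable (Q I) in
/-- `H²_V(Q,I)`: the set of equivalence classes of 2-cocycles compatible with `V`. -/
def Cohomology (V : MultVariety R S) : Type _ :=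
  Quot (fun T T' : Cocycle Q I V => ∃ h : Q → I, T.1.IsCobounding T'.1 h)

/-- `d : Q → I` is a derivation with respect to the action terms of `T`. -/
structure FactorData.IsDerivation (T : FactorData R S Q I) (d : Q → I) : Prop where
  add : ∀ x y, d (x + y) = d x + d y
  smul : ∀ (r : R) x, d (r • x) = r • d x
  op : ∀ (f : S.Op) (x : Fin (S.arity f) → Q),
    d (MultAlg.op (R := R) f x) =
      ∑ s : PropSub f, T.actAt f s x (d ∘ x) + MultAlg.op (R := R) f (d ∘ x)
  act : ∀ (f : S.Op) (s : PropSub f) (x : Fin (S.arity f) → Q) (a : Fin (S.arity f) → I),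
    ∑ r : PropSub f with s.1 ⊂ r.1, T.actAt f r x (s.1.piecewise a (d ∘ x))
      + MultAlg.op (R := R) f (s.1.piecewise a (d ∘ x)) = 0

/-- The factor system `T^(σ,κ)`. -/
def FactorData.twist (T : FactorData R S Q I) (g : MultAut R S I × MultAut R S Q) :
    FactorData R S Q I where
  add x y := g.1.1 (T.add (g.2.1.symm x) (g.2.1.symm y))
  smul r x := g.1.1 (T.smul r (g.2.1.symm x))
  op f x := g.1.1 (T.op f (fun i => g.2.1.symm (x i)))
  act f s x a := g.1.1 (T.act f s (fun i => g.2.1.symm (x i)) (fun i => g.1.1.symm (a i)))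

theorem FactorData.IsCocycle.twist {V : MultVariety R S} {T : FactorData R S Q I}
    (hT : T.IsCocycle V) (g : MultAut R S I × MultAut R S Q) : (T.twist g).IsCocycle V where
  act_zero_left f s x a hx := by
    obtain ⟨i, hi⟩ := hx
    have := hT.act_zero_left f s (fun i => g.2.1.symm (x i)) (fun i => g.1.1.symm (a i))
      ⟨i, by simp [hi]⟩
    simp [FactorData.twist, this]
  act_zero_right f s x a ha := by
    obtain ⟨i, hi⟩ := ha
    have := hT.act_zero_right f s (fun i => g.2.1.symm (x i)) (fun i => g.1.1.symm (a i))
      ⟨i, by simp [hi]⟩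
    simp [FactorData.twist, this]
  mem := by
    have h1 : ∀ (f : S.Op) (a : Fin (S.arity f) → I), g.1.1.symm (MultAlg.op (R := R) f a)
        = MultAlg.op (R := R) f (fun i => g.1.1.symm (a i)) := (g.1⁻¹).2
    have h2 : ∀ (f : S.Op) (a : Fin (S.arity f) → Q), g.2.1.symm (MultAlg.op (R := R) f a)
        = MultAlg.op (R := R) f (fun i => g.2.1.symm (a i)) := (g.2⁻¹).2
    refine hT.mem.of_injective (fun p => (g.1.1.symm p.1, g.2.1.symm p.2)) ?_ ?_ ?_ ?_ ?_
    · intro p q h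
      simpa [Prod.ext_iff] using h
    · simp [FactorData.semidirect]
    · intro x y
      simp [FactorData.semidirect, FactorData.twist]
    · intro r x
      simp [FactorData.semidirect, FactorData.twist]
    · intro f x
      simp [FactorData.semidirect, FactorData.twist, FactorData.actAt, h1, h2]

/-- The action of `Aut I × Aut Q` on the 2-cocycles compatible with `V`. -/
def Cocycle.twist {V : MultVariety R S} (T : Cocycle Q I V)
    (g : MultAut R S I × MultAut R S Q) : Cocycle Q I V :=
  ⟨T.1.twist g, T.2.twist g⟩

/-- The class `[T]` of a 2-cocycle. -/
def Cocycle.cls {V : MultVariety R S} (T : Cocycle Q I V) : Cohomology Q I V :=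
  Quot.mk _ T

/-- The Wells map `W_T(σ,κ) = [T] - [T^(σ,κ)]`, a formal difference in the free abelian group
generated by the cohomology classes. -/
noncomputable def Cocycle.wells {V : MultVariety R S} (T : Cocycle Q I V)
    (g : MultAut R S I × MultAut R S Q) : FreeAbelianGroup (Cohomology Q I V) :=
  FreeAbelianGroup.of T.cls - FreeAbelianGroup.of (T.twist g).cls

end Cocycles

/-! ### The 2-cocycle associated to an extension -/

section Associated

variable {R : Type*} [Ring R] {S : MultSig} {A Q : Type*}
  [AddCommGroup A] [Module R A] [MultAlg R S A] [AddCommGroup Q] [Module R Q] [MultAlg R S Q]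

/-- A lifting of `π : A → Q`: a map `l : Q → A` with `π ∘ l = id` and `l 0 = 0`. -/
structure Lifting (π : MultHom R S A Q) where
  toFun : Q → A
  section_apply : ∀ x, π.toLinearMap (toFun x) = x
  map_zero : toFun 0 = 0

/-- The tuple with entries `l (x i)` at the places outside `s` and `a i` at those in `s`. -/
def Lifting.mix {π : MultHom R S A Q} (l : Lifting π) {n : ℕ} (s : Finset (Fin n))
    (x : {i : Fin n // i ∉ s} → Q) (a : {i : Fin n // i ∈ s} → π.ker) : Fin n → A :=
  fun i => if h : i ∈ s then (a ⟨i, h⟩ : A) else l.toFun (x ⟨i, h⟩)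

/-- The factor system defined by a lifting. -/
def Lifting.factorData {π : MultHom R S A Q} (l : Lifting π) : FactorData R S Q π.ker where
  add x y := ⟨l.toFun x + l.toFun y - l.toFun (x + y), by simp [l.section_apply]⟩
  smul r x := ⟨r • l.toFun x - l.toFun (r • x), by simp [l.section_apply]⟩
  op f x := ⟨MultAlg.op (R := R) f (fun i => l.toFun (x i)) - l.toFun (MultAlg.op (R := R) f x),
    by simp [l.section_apply, π.map_op]⟩
  act f s x a := ⟨MultAlg.op (R := R) f (l.mix s.1 x a), by
    obtain ⟨i, hi⟩ := s.2.1
    refine π.op_mem_ker f _ i ?_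
    simp only [Lifting.mix, hi, dif_pos]
    exact (a ⟨i, hi⟩).2⟩

theorem Lifting.op_expand {π : MultHom R S A Q} (l : Lifting π) (f : S.Op)
    (x : Fin (S.arity f) → Q) (a : Fin (S.arity f) → π.ker) :
    MultAlg.op (R := R) f (fun i => (a i : A) + l.toFun (x i)) =
      MultAlg.op (R := R) f (fun i => (a i : A))
        + ∑ s : PropSub f, MultAlg.op (R := R) f (l.mix s.1 (fun i => x i) (fun i => a i))
        + MultAlg.op (R := R) f (fun i => l.toFun (x i)) := by
  classical
  have h1 := (MultAlg.op (R := R) (A := A) f).map_add_univ (fun i => (a i : A))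
    (fun i => l.toFun (x i))
  have h2 : ((fun i => (a i : A)) + fun i => l.toFun (x i)) =
      fun i => (a i : A) + l.toFun (x i) := rfl
  rw [h2] at h1
  have hne : (∅ : Finset (Fin (S.arity f))) ≠ Finset.univ := by
    intro h
    have : (⟨0, S.arity_pos f⟩ : Fin (S.arity f)) ∈ (∅ : Finset (Fin (S.arity f))) := by
      rw [h]; exact Finset.mem_univ _
    simp at this
  have h3 : ∀ s : PropSub f, l.mix s.1 (fun i => x i) (fun i => a i) =
      s.1.piecewise (fun i => (a i : A)) (fun i => l.toFun (x i)) := by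
    intro s
    funext i
    by_cases h : i ∈ s.1 <;> simp [Lifting.mix, h]
  simp only [h3]
  rw [h1, ← Finset.add_sum_erase _ _ (Finset.mem_univ Finset.univ),
    ← Finset.add_sum_erase _ _ (Finset.mem_erase.2 ⟨hne, Finset.mem_univ _⟩),
    Finset.piecewise_univ, Finset.piecewise_empty,
    ← Finset.sum_subtype (p := fun s : Finset (Fin (S.arity f)) => s.Nonempty ∧ s ≠ Finset.univ)
      ((Finset.univ.erase Finset.univ).erase ∅)
      (fun s => by simp [Finset.nonempty_iff_ne_empty])
      (fun s => MultAlg.op (R := R) f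
        (s.piecewise (fun i => (a i : A)) (fun i => l.toFun (x i))))]
  abel

theorem Lifting.isCocycle {π : MultHom R S A Q} (l : Lifting π) {V : MultVariety R S}
    (hA : V.Mem (MultAlg.toRaw R S A)) : l.factorData.IsCocycle V where
  act_zero_left f s x a hx := by
    obtain ⟨i, hi⟩ := hx
    apply Subtype.ext
    refine (MultAlg.op (R := R) (A := A) f).map_coord_zero i.1 ?_
    simp [Lifting.mix, i.2, hi, l.map_zero]
  act_zero_right f s x a ha := by
    obtain ⟨i, hi⟩ := ha
    apply Subtype.ext
    refine (MultAlg.op (R := R) (A := A) f).map_coord_zero i.1 ?_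
    simp [Lifting.mix, i.2, hi]
  mem := by
    refine hA.of_injective (fun p => (p.1 : A) + l.toFun p.2) ?_ ?_ ?_ ?_ ?_
    · rintro ⟨a, x⟩ ⟨b, y⟩ h
      have hx : x = y := by
        have := congrArg π.toLinearMap h
        simpa [l.section_apply] using this
      subst hx
      simpa using h
    · simp [FactorData.semidirect, MultAlg.toRaw, l.map_zero]
    · intro p q
      simp only [FactorData.semidirect, MultAlg.toRaw, Lifting.factorData, Submodule.coe_add]
      abel
    · intro r p
      simp only [FactorData.semidirect, MultAlg.toRaw, Lifting.factorData, Submodule.coe_add,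
        Submodule.coe_smul, smul_add]
      abel
    · intro f p
      have h := l.op_expand f (fun i => (p i).2) (fun i => (p i).1)
      simp only [FactorData.semidirect, MultAlg.toRaw, h, Lifting.factorData, Submodule.coe_add,
        Submodule.coe_sum, FactorData.actAt]
      have h2 : ((MultAlg.op (R := R) f (fun i => (p i).1) : π.ker) : A)
        = MultAlg.op (R := R) f (fun i => ((p i).1 : A)) := rfl
      rw [h2]
      abel

/-- The 2-cocycle defined by a lifting, associated to the extension `π : A → Q` with `A ∈ V`. -/
def Lifting.cocycle {π : MultHom R S A Q} (l : Lifting π) {V : MultVariety R S}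
    (hA : V.Mem (MultAlg.toRaw R S A)) : Cocycle Q π.ker V :=
  ⟨l.factorData, l.isCocycle hA⟩

end Associated

/-! Translating a lifting `l` with factor system `T` by a map `h : Q → I` changes `T` by the
coboundary of `h`; hence the 2-cocycles cohomologous to `T` are exactly the factor systems of the
other liftings, and the derivations are the differences of two liftings with the same factor system.
As `i + l x` runs through `A ≅ I ⋊_T Q`, an automorphism of `A` preserving `I` amounts to a pair
`(σ, κ)` together with a lifting `l'` whose factor system is `T^(σ,κ)`: it sends `i + l x` to
`σ i + l' (κ x)`. So `(σ, κ)` lifts to `A` iff `T^(σ,κ)` is cohomologous to `T`, and the lifts of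
`(1, 1)` correspond to the derivations. -/

/-! ### Expansion of multilinear operations -/

theorem comp_finset_piecewise {ι α β : Type*} [DecidableEq ι] (g : α → β) (s : Finset ι)
    (a b : ι → α) : g ∘ s.piecewise a b = s.piecewise (g ∘ a) (g ∘ b) := by
  ext i
  by_cases hi : i ∈ s <;> simp [hi]

section Multilinear

variable {R ι N : Type*} {M : ι → Type*} [DecidableEq ι]

theorem multilinearMap_piecewise_add [Semiring R] [Fintype ι] [∀ i, AddCommMonoid (M i)]
    [∀ i, Module R (M i)] [AddCommMonoid N] [Module R N] (g : MultilinearMap R M N)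
    (s : Finset ι) (a w u : ∀ i, M i) :
    g (s.piecewise a (w + u)) = ∑ r with s ⊆ r, g (r.piecewise (s.piecewise a w) u) := by
  have hsplit : s.piecewise a (w + u) =
      s.piecewise a w + s.piecewise (0 : ∀ i, M i) u := by
    ext i
    by_cases hi : i ∈ s <;> simp [hi]
  rw [hsplit, g.map_add_univ, Finset.sum_filter]
  refine Finset.sum_congr rfl fun r _ => ?_
  split_ifs with hr
  · congr 1
    ext i
    by_cases hi : i ∈ r
    · simp [hi]
    · simp [hi, Finset.piecewise_eq_of_notMem s _ _ fun his => hi (hr his)]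
  · obtain ⟨i, his, hir⟩ := Finset.not_subset.1 hr
    exact g.map_coord_zero i (by simp [his, hir])

theorem multilinearMap_piecewise_piecewise_neg [Ring R] [∀ i, AddCommGroup (M i)]
    [∀ i, Module R (M i)] [AddCommGroup N] [Module R N] (g : MultilinearMap R M N)
    {s r : Finset ι} (hsr : s ⊆ r) (a w u : ∀ i, M i) :
    g (r.piecewise (s.piecewise a (-w)) u) =
      (-1 : ℤ) ^ (r.card - s.card) • g (r.piecewise (s.piecewise a w) u) := by
  have hneg : r.piecewise (s.piecewise a (-w)) u =
      (r \ s).piecewise (fun i => (-1 : ℤ) • r.piecewise (s.piecewise a w) u i)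
        (r.piecewise (s.piecewise a w) u) := by
    ext i
    by_cases hr : i ∈ r <;> by_cases hs : i ∈ s <;> simp [hr, hs]
  have hsmul := (g.restrictScalars ℤ).map_piecewise_smul (fun _ => -1)
    (r.piecewise (s.piecewise a w) u) (r \ s)
  rw [Finset.prod_const, Finset.card_sdiff_of_subset hsr] at hsmul
  rw [hneg]
  exact hsmul

end Multilinear

theorem PropSub.sum_superset {S : MultSig} {f : S.Op} {M : Type*} [AddCommMonoid M]
    {s : Finset (Fin (S.arity f))} (hs : s ≠ Finset.univ) (F : Finset (Fin (S.arity f)) → M) :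
    ∑ r with s ⊆ r, F r = F s + ∑ r : PropSub f with s ⊂ r.1, F r.1 + F Finset.univ := by
  have hsplit : ({r | s ⊆ r} : Finset (Finset (Fin (S.arity f)))) =
      insert Finset.univ (insert s
        (({r | s ⊂ r.1} : Finset (PropSub f)).map (Function.Embedding.subtype _))) := by
    ext r
    simp only [Finset.mem_filter_univ, Finset.mem_insert, Finset.mem_map,
      Function.Embedding.subtype_apply, Subtype.exists, exists_and_right, exists_eq_right]
    constructor
    · intro hsr
      by_cases hr : r = Finset.univ
      · exact .inl hr
      · obtain rfl | hlt := hsr.eq_or_ssubset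
        · exact .inr (.inl rfl)
        · exact .inr (.inr ⟨⟨Finset.empty_ssubset.1 (s.empty_subset.trans_ssubset hlt), hr⟩, hlt⟩)
    · rintro (rfl | rfl | ⟨-, hlt⟩)
      exacts [Finset.subset_univ _, subset_rfl, hlt.subset]
  rw [hsplit, Finset.sum_insert (by simp [hs.symm]), Finset.sum_insert (by simp),
    Finset.sum_map, add_comm]
  rfl

section MultAlg

variable {R : Type*} [Ring R] {S : MultSig} {A : Type*} [AddCommGroup A] [Module R A]
  [MultAlg R S A]

theorem MultAlg.op_piecewise_add (f : S.Op) {s : Finset (Fin (S.arity f))} (hs : s ≠ Finset.univ)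
    (a w u : Fin (S.arity f) → A) :
    MultAlg.op (R := R) f (s.piecewise a (w + u)) =
      MultAlg.op (R := R) f (s.piecewise a u)
        + ∑ r : PropSub f with s ⊂ r.1, MultAlg.op (R := R) f (r.1.piecewise (s.piecewise a w) u)
        + MultAlg.op (R := R) f (s.piecewise a w) := by
  have hs' : s.piecewise (s.piecewise a w) u = s.piecewise a u := by
    ext i
    by_cases hi : i ∈ s <;> simp [hi]
  rw [multilinearMap_piecewise_add, PropSub.sum_superset hs, Finset.piecewise_univ, hs']

theorem MultAlg.op_piecewise_neg (f : S.Op) (s : Finset (Fin (S.arity f)))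
    (a w : Fin (S.arity f) → A) :
    MultAlg.op (R := R) f (s.piecewise a (-w)) =
      (-1 : ℤ) ^ (S.arity f - s.card) • MultAlg.op (R := R) f (s.piecewise a w) := by
  simpa using multilinearMap_piecewise_piecewise_neg (MultAlg.op (R := R) (A := A) f)
    s.subset_univ a w 0

end MultAlg

theorem FactorData.ext_actAt {R : Type*} {S : MultSig} {Q I : Type*} [Nonempty Q] [Nonempty I]
    {T U : FactorData R S Q I} (add : ∀ x y, T.add x y = U.add x y)
    (smul : ∀ r x, T.smul r x = U.smul r x) (op : ∀ f x, T.op f x = U.op f x)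
    (act : ∀ f s x a, T.actAt f s x a = U.actAt f s x a) : T = U := by
  ext f
  · exact add _ _
  · exact smul _ _
  · exact op _ _
  · rename_i s x a
    have hact := act f s (Function.extend Subtype.val x fun _ => Classical.arbitrary Q)
      (Function.extend Subtype.val a fun _ => Classical.arbitrary I)
    simpa only [actAt, Subtype.val_injective.extend_apply] using hact

section Cobounding

variable {R : Type*} [Ring R] {S : MultSig} {Q I : Type*}
  [AddCommGroup Q] [Module R Q] [MultAlg R S Q] [AddCommGroup I] [Module R I] [MultAlg R S I]

namespace FactorData.IsCobounding

variable {T T' U : FactorData R S Q I} {h : Q → I}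

theorem right_unique (hT : T.IsCobounding T' h) (hU : T.IsCobounding U h) : T' = U :=
  ext_actAt (fun x y => sub_right_injective ((hT.add x y).trans (hU.add x y).symm))
    (fun r x => sub_right_injective ((hT.smul r x).trans (hU.smul r x).symm))
    (fun f x => sub_right_injective ((hT.op f x).trans (hU.op f x).symm))
    (fun f s x a => sub_right_injective ((hT.act f s x a).trans (hU.act f s x a).symm))

-- The coboundary of `h` at `s` only involves action terms at strictly larger `r`.
theorem actAt_left_unique (hT : T.IsCobounding T' h) (hU : U.IsCobounding T' h) (f : S.Op)
    (s : PropSub f) (x : Fin (S.arity f) → Q) (a : Fin (S.arity f) → I) :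
    T.actAt f s x a = U.actAt f s x a := by
  induction s using WellFoundedGT.induction generalizing a with
  | ind s ih =>
    have hlarger : ∀ r : PropSub f, s.1 ⊂ r.1 → ∀ b, T.actAt f r x b = U.actAt f r x b :=
      fun r hr => ih r hr
    rw [← sub_left_inj, hT.act, hU.act, Finset.sum_congr rfl fun r hr => ?_]
    rw [hlarger r (Finset.mem_filter.1 hr).2]

theorem left_unique (hT : T.IsCobounding T' h) (hU : U.IsCobounding T' h) : T = U :=
  ext_actAt (fun x y => sub_left_injective ((hT.add x y).trans (hU.add x y).symm))
    (fun r x => sub_left_injective ((hT.smul r x).trans (hU.smul r x).symm))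
    (fun f x => by
      rw [← sub_left_inj, hT.op, hU.op]
      simp only [hT.actAt_left_unique hU])
    (hT.actAt_left_unique hU)

end FactorData.IsCobounding

end Cobounding

/-! ### Factor systems of liftings -/

namespace Lifting

variable {R : Type*} [Ring R] {S : MultSig} {A Q : Type*}
  [AddCommGroup A] [Module R A] [MultAlg R S A] [AddCommGroup Q] [Module R Q] [MultAlg R S Q]
  {π : MultHom R S A Q}

theorem ext_toFun {l l' : Lifting π} (h : ∀ x, l.toFun x = l'.toFun x) : l = l' := by
  cases l
  cases l'
  simpa only [mk.injEq] using funext h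

/-- The lifting `l + h`, for a map `h` from `Q` to the kernel. -/
def shift (l : Lifting π) (h : Q → π.ker) (h0 : h 0 = 0) : Lifting π where
  toFun x := h x + l.toFun x
  section_apply x := by rw [map_add, (h x).2, zero_add, l.section_apply]
  map_zero := by rw [h0, l.map_zero, ZeroMemClass.coe_zero, zero_add]

theorem shift_apply (l : Lifting π) {h : Q → π.ker} (h0 : h 0 = 0) (x : Q) :
    (l.shift h h0).toFun x = h x + l.toFun x :=
  rfl

/-- The difference of two liftings, as a map from `Q` to the kernel. -/
def diff (l' l : Lifting π) (x : Q) : π.ker :=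
  ⟨l'.toFun x - l.toFun x, by
    rw [LinearMap.mem_ker, map_sub, l'.section_apply, l.section_apply, sub_self]⟩

theorem diff_zero (l' l : Lifting π) : l'.diff l 0 = 0 :=
  Subtype.ext (by simp only [diff, l.map_zero, l'.map_zero, sub_self, ZeroMemClass.coe_zero])

theorem shift_diff (l l' : Lifting π) : l.shift (l'.diff l) (l'.diff_zero l) = l' :=
  ext_toFun fun _ => sub_add_cancel _ _

theorem shift_zero (l : Lifting π) : l.shift 0 rfl = l :=
  ext_toFun fun _ => zero_add _

theorem shift_add (l : Lifting π) {d e : Q → π.ker} (hd : d 0 = 0) (he : e 0 = 0)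
    (hde : (d + e) 0 = 0) : l.shift (d + e) hde = (l.shift d hd).shift e he :=
  ext_toFun fun x => by simp only [shift_apply, Pi.add_apply, Submodule.coe_add]; abel

theorem shift_shift_neg (l : Lifting π) {h : Q → π.ker} (h0 : h 0 = 0) :
    (l.shift h h0).shift (-h) (neg_eq_zero.2 h0) = l :=
  ext_toFun fun _ => neg_add_cancel_left _ _

theorem coe_actAt (l : Lifting π) (f : S.Op) (s : PropSub f) (x : Fin (S.arity f) → Q)
    (a : Fin (S.arity f) → π.ker) :
    (l.factorData.actAt f s x a : A) =
      MultAlg.op (R := R) f (s.1.piecewise (Subtype.val ∘ a) (l.toFun ∘ x)) :=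
  rfl

theorem coe_op (l : Lifting π) (f : S.Op) (x : Fin (S.arity f) → Q) :
    (l.factorData.op f x : A) =
      MultAlg.op (R := R) f (l.toFun ∘ x) - l.toFun (MultAlg.op (R := R) f x) :=
  rfl

theorem actAt_piecewise_neg (l : Lifting π) (f : S.Op) {s : Finset (Fin (S.arity f))}
    {r : PropSub f} (hsr : s ⊆ r.1) (x : Fin (S.arity f) → Q) (a w : Fin (S.arity f) → π.ker) :
    l.factorData.actAt f r x (s.piecewise a (-w)) =
      (-1 : ℤ) ^ (r.1.card - s.card) • l.factorData.actAt f r x (s.piecewise a w) := by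
  ext
  rw [AddSubgroupClass.coe_zsmul, coe_actAt, coe_actAt, comp_finset_piecewise,
    comp_finset_piecewise]
  exact multilinearMap_piecewise_piecewise_neg (MultAlg.op (R := R) f) hsr _ (Subtype.val ∘ w) _

section Shift

variable (l : Lifting π) {h : Q → π.ker} (h0 : h 0 = 0)

theorem shift_add_apply (x y : Q) :
    (l.shift h h0).factorData.add x y = l.factorData.add x y + (h x + h y - h (x + y)) := by
  ext
  simp only [factorData, shift_apply, Submodule.coe_add, Submodule.coe_sub]
  abel

theorem shift_smul_apply (r : R) (x : Q) :
    (l.shift h h0).factorData.smul r x = l.factorData.smul r x + (r • h x - h (r • x)) := by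
  ext
  simp only [factorData, shift_apply, Submodule.coe_add, Submodule.coe_sub, Submodule.coe_smul,
    smul_add]
  abel

theorem shift_actAt (f : S.Op) (s : PropSub f) (x : Fin (S.arity f) → Q)
    (a : Fin (S.arity f) → π.ker) :
    (l.shift h h0).factorData.actAt f s x a = l.factorData.actAt f s x a
      + (∑ r : PropSub f with s.1 ⊂ r.1, l.factorData.actAt f r x (s.1.piecewise a (h ∘ x))
        + MultAlg.op (R := R) f (s.1.piecewise a (h ∘ x))) := by
  ext
  have hop := MultAlg.op_piecewise_add (R := R) f s.2.2 (Subtype.val ∘ a)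
    (Subtype.val ∘ h ∘ x) (l.toFun ∘ x)
  rw [← comp_finset_piecewise _ s.1 a] at hop
  simp only [Submodule.coe_add, Submodule.coe_sum, coe_actAt, ← add_assoc]
  exact hop

theorem shift_op (f : S.Op) (x : Fin (S.arity f) → Q) :
    (l.shift h h0).factorData.op f x = l.factorData.op f x
      + (∑ r : PropSub f, l.factorData.actAt f r x (h ∘ x) + MultAlg.op (R := R) f (h ∘ x)
        - h (MultAlg.op (R := R) f x)) := by
  ext
  have hop : MultAlg.op (R := R) f ((l.shift h h0).toFun ∘ x) =
      (MultAlg.op (R := R) f (h ∘ x) : π.ker)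
        + ∑ r : PropSub f, (l.factorData.actAt f r x (h ∘ x) : A)
        + MultAlg.op (R := R) f (l.toFun ∘ x) :=
    l.op_expand f x (h ∘ x)
  simp only [Submodule.coe_add, Submodule.coe_sub, Submodule.coe_sum, coe_op, hop, shift_apply]
  abel

end Shift

theorem isDerivation_iff (l : Lifting π) {d : Q → π.ker} :
    l.factorData.IsDerivation d ↔ ∃ d0 : d 0 = 0, (l.shift d d0).factorData = l.factorData := by
  constructor
  · intro hd
    have d0 : d 0 = 0 := by simpa using hd.smul 0 0
    refine ⟨d0, FactorData.ext_actAt (fun x y => ?_) (fun r x => ?_) (fun f x => ?_)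
      fun f s x a => ?_⟩
    · rw [shift_add_apply, hd.add, sub_self, add_zero]
    · rw [shift_smul_apply, hd.smul, sub_self, add_zero]
    · rw [shift_op, hd.op, sub_self, add_zero]
    · rw [shift_actAt, hd.act, add_zero]
  · rintro ⟨d0, hd⟩
    constructor
    · intro x y
      rw [eq_comm, ← sub_eq_zero, ← add_eq_left, ← l.shift_add_apply d0, hd]
    · intro r x
      rw [eq_comm, ← sub_eq_zero, ← add_eq_left, ← l.shift_smul_apply d0, hd]
    · intro f x
      rw [eq_comm, ← sub_eq_zero, ← add_eq_left, ← l.shift_op d0, hd]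
    · intro f s x a
      rw [← add_eq_left, ← l.shift_actAt d0, hd]

theorem isCobounding_shift_neg (l : Lifting π) {h : Q → π.ker} (h0 : h 0 = 0) :
    l.factorData.IsCobounding (l.shift (-h) (neg_eq_zero.2 h0)).factorData h where
  map_zero := h0
  add x y := by
    rw [shift_add_apply]
    simp only [Pi.neg_apply]
    abel
  smul r x := by
    rw [shift_smul_apply]
    simp only [Pi.neg_apply, smul_neg]
    abel
  op f x := by
    have hact : ∀ r : PropSub f, l.factorData.actAt f r x (-(h ∘ x)) =
        (-1 : ℤ) ^ r.1.card • l.factorData.actAt f r x (h ∘ x) := fun r => by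
      simpa using l.actAt_piecewise_neg f r.1.empty_subset x 0 (h ∘ x)
    have hop := MultAlg.op_piecewise_neg (R := R) f ∅ 0 (h ∘ x)
    rw [Finset.piecewise_empty, Finset.piecewise_empty, Finset.card_empty, Nat.sub_zero] at hop
    rw [shift_op, show (-h) ∘ x = -(h ∘ x) from rfl, hop]
    simp only [hact, pow_add, pow_one, neg_one_mul, neg_smul, Finset.sum_neg_distrib, Pi.neg_apply]
    abel
  act f s x a := by
    rw [shift_actAt, show (-h) ∘ x = -(h ∘ x) from rfl, MultAlg.op_piecewise_neg,
      Finset.sum_congr rfl fun r hr =>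
        l.actAt_piecewise_neg f (Finset.mem_filter.1 hr).2.subset x a (h ∘ x)]
    simp only [pow_add, pow_one, neg_one_mul, neg_smul, Finset.sum_neg_distrib]
    abel

theorem isCobounding_shift (l : Lifting π) {h : Q → π.ker} (h0 : h 0 = 0) :
    (l.shift h h0).factorData.IsCobounding l.factorData h := by
  have hneg := (l.shift h h0).isCobounding_shift_neg h0
  rwa [shift_shift_neg] at hneg

/-- The group of derivations with respect to the factor system of a lifting. -/
def derivations (l : Lifting π) : AddSubgroup (Q → π.ker) where
  carrier := {d | l.factorData.IsDerivation d}
  zero_mem' := l.isDerivation_iff.2 ⟨rfl, by rw [shift_zero]⟩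
  add_mem' {d e} hd he := by
    obtain ⟨d0, hld⟩ := l.isDerivation_iff.1 hd
    rw [Set.mem_ofPred_eq, ← hld] at he
    obtain ⟨e0, hle⟩ := (l.shift d d0).isDerivation_iff.1 he
    have hde0 : (d + e) 0 = 0 := by rw [Pi.add_apply, d0, e0, add_zero]
    exact l.isDerivation_iff.2 ⟨hde0, by rw [l.shift_add d0 e0, hle, hld]⟩
  neg_mem' {d} hd := by
    obtain ⟨d0, hld⟩ := l.isDerivation_iff.1 hd
    have hself := l.isCobounding_shift d0
    rw [hld] at hself
    exact l.isDerivation_iff.2 ⟨_, (l.isCobounding_shift_neg d0).right_unique hself⟩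

theorem exists_factorData_eq_iff_of_isCobounding {T T' : FactorData R S Q π.ker} {h : Q → π.ker}
    (hT : T.IsCobounding T' h) :
    (∃ l : Lifting π, T = l.factorData) ↔ ∃ l : Lifting π, T' = l.factorData := by
  constructor
  · rintro ⟨l, rfl⟩
    exact ⟨_, hT.right_unique (l.isCobounding_shift_neg hT.map_zero)⟩
  · rintro ⟨l, rfl⟩
    exact ⟨_, hT.left_unique (l.isCobounding_shift hT.map_zero)⟩

theorem cls_eq_cls_cocycle_iff {V : MultVariety R S} (hA : V.Mem (MultAlg.toRaw R S A))
    (l : Lifting π) (T : Cocycle Q π.ker V) :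
    T.cls = (l.cocycle hA).cls ↔ ∃ l' : Lifting π, T.1 = l'.factorData := by
  constructor
  · intro hcls
    let IsOfLifting : Cohomology Q π.ker V → Prop :=
      Quot.lift (fun T => ∃ l' : Lifting π, T.1 = l'.factorData)
        fun _ _ ⟨_, hT⟩ => propext (exists_factorData_eq_iff_of_isCobounding hT)
    have hl : IsOfLifting (l.cocycle hA).cls := ⟨l, rfl⟩
    rwa [← hcls] at hl
  · rintro ⟨l', hl'⟩
    have hcob := l.isCobounding_shift (l'.diff_zero l)
    rw [shift_diff, ← hl'] at hcob
    exact Quot.sound ⟨_, hcob⟩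

end Lifting

/-! ### Automorphisms preserving the kernel -/

/-- `e` is a homomorphism of algebras in the signature `{0, +, r · (r ∈ R)} ∪ S`. -/
structure RawAlg.IsHom {R : Type*} {S : MultSig} {X Y : Type*} (B : RawAlg R S X)
    (C : RawAlg R S Y) (e : X → Y) : Prop where
  map_zero : e B.zero = C.zero
  map_add : ∀ x y, e (B.add x y) = C.add (e x) (e y)
  map_smul : ∀ r x, e (B.smul r x) = C.smul r (e x)
  map_op : ∀ f x, e (B.op f x) = C.op f (e ∘ x)

namespace RawAlg.IsHom

variable {R : Type*} {S : MultSig} {X Y Z : Type*} {B : RawAlg R S X} {C : RawAlg R S Y}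
  {D : RawAlg R S Z}

theorem comp {g : Y → Z} {e : X → Y} (hg : IsHom C D g) (he : IsHom B C e) :
    IsHom B D (g ∘ e) where
  map_zero := by rw [Function.comp_apply, he.map_zero, hg.map_zero]
  map_add x y := by simp only [Function.comp_apply, he.map_add, hg.map_add]
  map_smul r x := by simp only [Function.comp_apply, he.map_smul, hg.map_smul]
  map_op f x := by simp only [Function.comp_apply, he.map_op, hg.map_op, Function.comp_assoc]

theorem symm {e : X ≃ Y} (he : IsHom B C e) : IsHom C B e.symm where
  map_zero := by rw [← he.map_zero, e.symm_apply_apply]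
  map_add x y := by rw [e.symm_apply_eq, he.map_add, e.apply_symm_apply, e.apply_symm_apply]
  map_smul r x := by rw [e.symm_apply_eq, he.map_smul, e.apply_symm_apply]
  map_op f x := by
    rw [e.symm_apply_eq, he.map_op, ← Function.comp_assoc, e.self_comp_symm, Function.id_comp]

end RawAlg.IsHom

/-- An isomorphism of the underlying raw algebra with itself, as an automorphism. -/
def MultAut.ofIsHom {R : Type*} [Ring R] {S : MultSig} {A : Type*} [AddCommGroup A] [Module R A]
    [MultAlg R S A] (e : A ≃ A) (he : (MultAlg.toRaw R S A).IsHom (MultAlg.toRaw R S A) e) :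
    MultAut R S A :=
  ⟨{ e with map_add' := he.map_add, map_smul' := he.map_smul }, he.map_op⟩

theorem FactorData.actAt_twist {R : Type*} [Ring R] {S : MultSig} {Q I : Type*}
    [AddCommGroup Q] [Module R Q] [MultAlg R S Q] [AddCommGroup I] [Module R I] [MultAlg R S I]
    (T : FactorData R S Q I) (g : MultAut R S I × MultAut R S Q) (f : S.Op) (s : PropSub f)
    (x : Fin (S.arity f) → Q) (a : Fin (S.arity f) → I) :
    (T.twist g).actAt f s x a = g.1.1 (T.actAt f s (g.2.1.symm ∘ x) (g.1.1.symm ∘ a)) :=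
  rfl

theorem FactorData.isHom_twist {R : Type*} [Ring R] {S : MultSig} {Q I : Type*}
    [AddCommGroup Q] [Module R Q] [MultAlg R S Q] [AddCommGroup I] [Module R I] [MultAlg R S I]
    (T : FactorData R S Q I) (g : MultAut R S I × MultAut R S Q) :
    T.semidirect.IsHom (T.twist g).semidirect (Prod.map g.1.1 g.2.1) where
  map_zero := by simp [semidirect]
  map_add p q := by simp [semidirect, twist]
  map_smul r p := by simp [semidirect, twist]
  map_op f p := by
    have hI := g.1.2 f
    have hQ := g.2.2 f
    simp [semidirect, twist, actAt, hI, hQ]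

section Kernel

variable {R : Type*} [Ring R] {S : MultSig} {A Q : Type*}
  [AddCommGroup A] [Module R A] [MultAlg R S A] [AddCommGroup Q] [Module R Q] [MultAlg R S Q]
  {π : MultHom R S A Q}

namespace MultAutKer

theorem ext {φ χ : MultAutKer π} (h : ∀ a, φ.1.1 a = χ.1.1 a) : φ = χ :=
  Subtype.ext (Subtype.ext (LinearEquiv.ext h))

theorem map_congr (φ : MultAutKer π) {a b : A} (hab : π.toLinearMap a = π.toLinearMap b) :
    π.toLinearMap (φ.1.1 a) = π.toLinearMap (φ.1.1 b) := by
  rw [← sub_eq_zero, ← map_sub, ← LinearMap.mem_ker] at hab ⊢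
  rw [← map_sub]
  exact (φ.2 _).2 hab

/-- The restriction `φ ↦ φ|_I` to the kernel. -/
def restrict : MultAutKer π →* MultAut R S π.ker where
  toFun φ := MultAut.ofIsHom (φ.1.1.toEquiv.subtypeEquiv fun a => (φ.2 a).symm)
    { map_zero := Subtype.ext (map_zero φ.1.1)
      map_add := fun _ _ => Subtype.ext (map_add φ.1.1 _ _)
      map_smul := fun _ _ => Subtype.ext (map_smul φ.1.1 _ _)
      map_op := fun f _ => Subtype.ext (φ.1.2 f _) }
  map_one' := rfl
  map_mul' _ _ := rfl

end MultAutKer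

namespace Lifting

theorem surjective (l : Lifting π) : Function.Surjective π.toLinearMap :=
  fun x => ⟨l.toFun x, l.section_apply x⟩

variable (l l' : Lifting π)

/-- The map `π ∘ φ ∘ l`, as a permutation of `Q`. -/
def inducedEquiv (φ : MultAutKer π) : Q ≃ Q where
  toFun x := π.toLinearMap (φ.1.1 (l.toFun x))
  invFun x := π.toLinearMap (φ⁻¹.1.1 (l.toFun x))
  left_inv _ := (MultAutKer.map_congr φ⁻¹ (l.section_apply _)).trans <|
    (congrArg π.toLinearMap (φ.1.1.symm_apply_apply _)).trans (l.section_apply _)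
  right_inv _ := (MultAutKer.map_congr φ (l.section_apply _)).trans <|
    (congrArg π.toLinearMap (φ.1.1.apply_symm_apply _)).trans (l.section_apply _)

theorem inducedEquiv_apply (φ : MultAutKer π) (a : A) :
    l.inducedEquiv φ (π.toLinearMap a) = π.toLinearMap (φ.1.1 a) :=
  MultAutKer.map_congr φ (l.section_apply _)

theorem isHom_inducedEquiv (φ : MultAutKer π) :
    (MultAlg.toRaw R S Q).IsHom (MultAlg.toRaw R S Q) (l.inducedEquiv φ) where
  map_zero := by
    rw [MultAlg.toRaw, ← π.toLinearMap.map_zero, inducedEquiv_apply, LinearEquiv.map_zero]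
  map_add x y := by
    obtain ⟨a, rfl⟩ := l.surjective x
    obtain ⟨b, rfl⟩ := l.surjective y
    simp only [MultAlg.toRaw, inducedEquiv_apply, ← map_add]
  map_smul r x := by
    obtain ⟨a, rfl⟩ := l.surjective x
    simp only [MultAlg.toRaw, inducedEquiv_apply, ← map_smul]
  map_op f x := by
    obtain ⟨a, rfl⟩ := l.surjective.comp_left x
    simp only [MultAlg.toRaw, Function.comp_def, inducedEquiv_apply, ← π.map_op, φ.1.2 f a]

/-- The automorphism `π ∘ φ ∘ l` of `Q` induced by an automorphism `φ` of `A`. -/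
def induced : MultAutKer π →* MultAut R S Q where
  toFun φ := MultAut.ofIsHom (l.inducedEquiv φ) (l.isHom_inducedEquiv φ)
  map_one' := Subtype.ext (LinearEquiv.ext l.section_apply)
  map_mul' φ _ := Subtype.ext (LinearEquiv.ext fun _ => (l.inducedEquiv_apply φ _).symm)

theorem induced_apply (φ : MultAutKer π) (a : A) :
    (l.induced φ).1 (π.toLinearMap a) = π.toLinearMap (φ.1.1 a) :=
  l.inducedEquiv_apply φ a

/-- The map `ψ : φ ↦ (φ|_I, π ∘ φ ∘ l)`. -/
def autPair : MultAutKer π →* MultAut R S π.ker × MultAut R S Q :=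
  MultAutKer.restrict.prod l.induced

theorem map_ker_add (i : π.ker) (x : Q) : π.toLinearMap (i + l.toFun x) = x := by
  rw [map_add, i.2, zero_add, l.section_apply]

theorem coe_autPair_fst (φ : MultAutKer π) (i : π.ker) :
    ((l.autPair φ).1.1 i : A) = φ.1.1 i :=
  rfl

theorem autPair_snd (φ : MultAutKer π) : (l.autPair φ).2 = l.induced φ :=
  rfl

/-- The bijection `(i, x) ↦ i + l x` from `I ⋊_T Q` to `A`, where `T` is the factor system
of `l`. -/
def pairEquiv : π.ker × Q ≃ A where
  toFun p := p.1 + l.toFun p.2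
  invFun a := (⟨a - l.toFun (π.toLinearMap a), by
    rw [LinearMap.mem_ker, map_sub, l.section_apply, sub_self]⟩, π.toLinearMap a)
  left_inv p := Prod.ext
    (Subtype.ext <| by simp only [map_ker_add, add_sub_cancel_right]) (l.map_ker_add p.1 p.2)
  right_inv _ := sub_add_cancel _ _

theorem isHom_pairEquiv : l.factorData.semidirect.IsHom (MultAlg.toRaw R S A) l.pairEquiv where
  map_zero := (zero_add _).trans l.map_zero
  map_add p q := by
    simp only [pairEquiv, Equiv.coe_fn_mk, FactorData.semidirect, MultAlg.toRaw, factorData,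
      Submodule.coe_add]
    abel
  map_smul r p := by
    simp only [pairEquiv, Equiv.coe_fn_mk, FactorData.semidirect, MultAlg.toRaw, factorData,
      Submodule.coe_add, Submodule.coe_smul, smul_add]
    abel
  map_op f p := by
    have hop : MultAlg.op (R := R) f (l.pairEquiv ∘ p) =
        (MultAlg.op (R := R) f (fun i => (p i).1) : π.ker)
          + ∑ s : PropSub f,
            (l.factorData.actAt f s (fun i => (p i).2) (fun i => (p i).1) : A)
          + MultAlg.op (R := R) f (l.toFun ∘ fun i => (p i).2) :=
      l.op_expand f _ _
    refine Eq.trans ?_ hop.symm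
    simp only [pairEquiv, Equiv.coe_fn_mk, FactorData.semidirect, Submodule.coe_add,
      Submodule.coe_sum, coe_op]
    abel

/-- The automorphism `i + l x ↦ σ i + l' (κ x)` of `A`, for a pair `g = (σ, κ)` that takes the
factor system of `l` to that of `l'`. -/
def glue (g : MultAut R S π.ker × MultAut R S Q)
    (hg : l.factorData.twist g = l'.factorData) : MultAutKer π :=
  ⟨MultAut.ofIsHom
    ((l.pairEquiv.symm.trans (g.1.1.toEquiv.prodCongr g.2.1.toEquiv)).trans l'.pairEquiv)
    (l'.isHom_pairEquiv.comp ((hg ▸ l.factorData.isHom_twist g).comp l.isHom_pairEquiv.symm)),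
    fun a => by
      have hπ : π.toLinearMap (l'.pairEquiv (g.1.1 (l.pairEquiv.symm a).1,
          g.2.1 (π.toLinearMap a))) = g.2.1 (π.toLinearMap a) := l'.map_ker_add _ _
      simpa only [LinearMap.mem_ker] using hπ ▸ g.2.1.map_eq_zero_iff⟩

section Glue

variable {l l'} {g : MultAut R S π.ker × MultAut R S Q}
  (hg : l.factorData.twist g = l'.factorData)

theorem glue_apply (i : π.ker) (x : Q) :
    (l.glue l' g hg).1.1 (i + l.toFun x) = g.1.1 i + l'.toFun (g.2.1 x) :=
  congrArg (fun p : π.ker × Q => (g.1.1 p.1 + l'.toFun (g.2.1 p.2) : A))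
    (l.pairEquiv.symm_apply_apply (i, x))

theorem autPair_glue : l.autPair (l.glue l' g hg) = g := by
  refine Prod.ext (Subtype.ext (LinearEquiv.ext fun i => ?_))
    (Subtype.ext (LinearEquiv.ext fun x => ?_))
  · have hi := glue_apply hg i 0
    rw [LinearEquiv.map_zero, l.map_zero, l'.map_zero, add_zero, add_zero] at hi
    exact Subtype.ext hi
  · have hx := congrArg π.toLinearMap (glue_apply hg 0 x)
    rw [map_ker_add, ZeroMemClass.coe_zero, zero_add] at hx
    exact hx

end Glue

/-- The lifting `φ ∘ l ∘ κ⁻¹`, where `κ` is the automorphism of `Q` induced by `φ`. -/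
def conj (φ : MultAutKer π) : Lifting π where
  toFun x := φ.1.1 (l.toFun ((l.induced φ).1.symm x))
  section_apply x := by
    rw [← l.induced_apply, l.section_apply, LinearEquiv.apply_symm_apply]
  map_zero := by rw [LinearEquiv.map_zero, l.map_zero, LinearEquiv.map_zero]

theorem conj_induced_apply (φ : MultAutKer π) (x : Q) :
    (l.conj φ).toFun ((l.induced φ).1 x) = φ.1.1 (l.toFun x) :=
  congrArg (φ.1.1 ∘ l.toFun) ((l.induced φ).1.symm_apply_apply x)

theorem twist_autPair (φ : MultAutKer π) :
    l.factorData.twist (l.autPair φ) = (l.conj φ).factorData := by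
  refine FactorData.ext_actAt (fun x y => Subtype.ext ?_) (fun r x => Subtype.ext ?_)
    (fun f x => Subtype.ext ?_) fun f s x a => Subtype.ext ?_
  · simp only [FactorData.twist, coe_autPair_fst, autPair_snd, factorData, conj, map_sub, map_add]
  · simp only [FactorData.twist, coe_autPair_fst, autPair_snd, factorData, conj, map_sub, map_smul]
  · have hκ : (l.induced φ).1.symm (MultAlg.op (R := R) f x) =
        MultAlg.op (R := R) f fun i => (l.induced φ).1.symm (x i) := (l.induced φ)⁻¹.2 f x
    simp only [FactorData.twist, coe_autPair_fst, autPair_snd, factorData, conj, map_sub, hκ,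
      φ.1.2 f _]
  · have ha : φ.1.1 ∘ Subtype.val ∘ (l.autPair φ).1.1.symm ∘ a = Subtype.val ∘ a :=
      funext fun i => congrArg Subtype.val ((l.autPair φ).1.1.apply_symm_apply (a i))
    rw [FactorData.actAt_twist, coe_autPair_fst, coe_actAt, coe_actAt, φ.1.2 f]
    change MultAlg.op (R := R) f (φ.1.1 ∘ _) = _
    rw [comp_finset_piecewise, ha]
    rfl

theorem glue_conj (φ : MultAutKer π) :
    l.glue (l.conj φ) (l.autPair φ) (l.twist_autPair φ) = φ := by
  refine MultAutKer.ext fun a => ?_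
  obtain ⟨⟨i, x⟩, rfl⟩ := l.pairEquiv.surjective a
  calc (l.glue (l.conj φ) (l.autPair φ) _).1.1 (i + l.toFun x)
      = φ.1.1 i + (l.conj φ).toFun ((l.induced φ).1 x) := glue_apply _ i x
    _ = φ.1.1 (i + l.toFun x) := by rw [conj_induced_apply, LinearEquiv.map_add]

theorem range_autPair : Set.range l.autPair =
    {g | ∃ l' : Lifting π, l.factorData.twist g = l'.factorData} := by
  ext g
  constructor
  · rintro ⟨φ, rfl⟩
    exact ⟨_, l.twist_autPair φ⟩
  · rintro ⟨l', hg⟩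
    exact ⟨_, autPair_glue hg⟩

theorem wells_eq_zero_iff {V : MultVariety R S} (hA : V.Mem (MultAlg.toRaw R S A))
    (g : MultAut R S π.ker × MultAut R S Q) :
    (l.cocycle hA).wells g = 0 ↔ ∃ l' : Lifting π, l.factorData.twist g = l'.factorData := by
  rw [Cocycle.wells, sub_eq_zero, FreeAbelianGroup.of_injective.eq_iff, eq_comm,
    cls_eq_cls_cocycle_iff]
  rfl

/-- The automorphism `ι d : a ↦ a + d (π a)` given by a derivation `d`. -/
def derivationAut (d : l.derivations) : MultAutKer π :=
  l.glue (l.shift d.1 (l.isDerivation_iff.1 d.2).fst) 1 (l.isDerivation_iff.1 d.2).snd.symm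

theorem derivationAut_apply (d : l.derivations) (a : A) :
    (l.derivationAut d).1.1 a = a + (d.1 (π.toLinearMap a) : A) := by
  obtain ⟨⟨i, x⟩, rfl⟩ := l.pairEquiv.surjective a
  calc (l.derivationAut d).1.1 (i + l.toFun x)
      = i + (d.1 x + l.toFun x) := glue_apply _ i x
    _ = i + l.toFun x + d.1 (π.toLinearMap (i + l.toFun x)) := by
      rw [map_ker_add, add_comm (d.1 x : A), add_assoc]

theorem autPair_derivationAut (d : l.derivations) : l.autPair (l.derivationAut d) = 1 :=
  autPair_glue _

/-- The homomorphism `ι` from the derivations to the automorphisms preserving the kernel. -/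
def derivationHom : Multiplicative l.derivations →* MultAutKer π :=
  MonoidHom.mk' (fun d => l.derivationAut d.toAdd) fun d e => MultAutKer.ext fun a => by
    change _ = (l.derivationAut d.toAdd).1.1 ((l.derivationAut e.toAdd).1.1 a)
    have ha : π.toLinearMap (a + (e.toAdd.1 (π.toLinearMap a) : A)) = π.toLinearMap a := by
      rw [map_add, (e.toAdd.1 _).2, add_zero]
    simp only [derivationAut_apply, ha, toAdd_mul, AddSubgroup.coe_add, Pi.add_apply,
      Submodule.coe_add]
    abel

theorem derivationHom_injective : Function.Injective l.derivationHom := by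
  intro d e hde
  refine Subtype.ext (funext fun x => Subtype.ext ?_)
  have hx := congrArg (fun φ : MultAutKer π => φ.1.1 (l.toFun x)) hde
  simp only [derivationHom, MonoidHom.mk'_apply, derivationAut_apply, l.section_apply] at hx
  exact add_left_cancel hx

theorem range_derivationHom : l.derivationHom.range = l.autPair.ker := by
  ext φ
  constructor
  · rintro ⟨d, rfl⟩
    exact l.autPair_derivationAut d.toAdd
  · intro (hφ : l.autPair φ = 1)
    have hl := l.twist_autPair φ
    rw [hφ] at hl
    have hd : l.factorData.IsDerivation ((l.conj φ).diff l) :=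
      l.isDerivation_iff.2 ⟨_, by rw [shift_diff]; exact hl.symm⟩
    refine ⟨Multiplicative.ofAdd ⟨_, hd⟩, ?_⟩
    refine Eq.trans ?_ (l.glue_conj φ)
    simp only [hφ, derivationHom, MonoidHom.mk'_apply, derivationAut, shift_diff, toAdd_ofAdd]

end Lifting

end Kernel

/-- Exactness of `1 → Der(Q,I) → Aut_I A → Aut I × Aut Q → FA(H²_V(Q,I))` for an extension
`π : A → Q` in `V` with kernel `I` and the 2-cocycle `T` associated to it by a lifting `l`. -/
theorem theorem4 {R : Type*} [Ring R] {S : MultSig} (V : MultVariety R S) {A Q : Type*}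
    [AddCommGroup A] [Module R A] [MultAlg R S A] [AddCommGroup Q] [Module R Q] [MultAlg R S Q]
    (hA : V.Mem (MultAlg.toRaw R S A)) (π : MultHom R S A Q)
    (hπ : Function.Surjective π.toLinearMap) (l : Lifting π)
    (T : Cocycle Q π.ker V) (hT : T = l.cocycle hA) :
    ∃ (Der : AddSubgroup (Q → π.ker)) (ι : Multiplicative Der →* MultAutKer π)
      (ψ : MultAutKer π →* MultAut R S π.ker × MultAut R S Q),
      -- `Der` consists of the derivations, and `ι d` is the automorphism `a ↦ a + d (π a)`
      (∀ d : Q → π.ker, d ∈ Der ↔ T.1.IsDerivation d) ∧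
      (∀ (d : Der) (a : A), (ι (Multiplicative.ofAdd d)).1.1 a = a + (d.1 (π.toLinearMap a) : A)) ∧
      -- `ψ φ` is the pair of the restriction of `φ` to the kernel and of `π ∘ φ ∘ l'`
      (∀ (φ : MultAutKer π) (i : π.ker), (((ψ φ).1.1 i : π.ker) : A) = φ.1.1 (i : A)) ∧
      (∀ (φ : MultAutKer π) (l' : Q → A), (∀ x, π.toLinearMap (l' x) = x) →
        ∀ x : Q, (ψ φ).2.1 x = π.toLinearMap (φ.1.1 (l' x))) ∧
      -- exactness
      Function.Injective ι ∧
      ι.range = ψ.ker ∧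
      Set.range ψ = {g | T.wells g = 0} := by
  subst hT
  refine ⟨l.derivations, l.derivationHom, l.autPair, fun _ => Iff.rfl, l.derivationAut_apply,
    fun _ _ => rfl, fun φ l' hl' x => ?_, l.derivationHom_injective, l.range_derivationHom, ?_⟩
  · conv_lhs => rw [← hl' x]
    exact l.induced_apply φ (l' x)
  · rw [Lifting.range_autPair]
    exact Set.ext fun g => (l.wells_eq_zero_iff hA g).symm
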